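/- For a permutation $\sigma\in\mathfrak{S}_n$ let $\mathrm{Des}(\sigma)=\{1\le i\le n-1:\sigma(i)>\sigma(i+1)\}$, and for a composition $I=(i_1,\dots,i_r)$ of $n$ let $\mathrm{Des}(I)=\{i_1,i_1+i_2,\dots,i_1+\dots+i_{r-1}\}$. In the group algebra $\mathbb{Q}[\mathfrak{S}_n]$ (with $(\sigma\tau)(i)=\sigma(\tau(i))$) put $$R_I=\sum_{\mathrm{Des}(\sigma)=\mathrm{Des}(I)}\sigma,\qquad S^I=\sum_{\mathrm{Des}(\sigma)\subseteq\mathrm{Des}(I)}\sigma .$$ Let $\mathbf{Sym}_n$ be the linear span of the $R_I$ with $I$ a composition of $n$; the $S^I$ form a basis of it. Let $\widehat{\mathbf{Sym}}=\prod_{n\ge 0}\mathbf{Sym}_n$, whose elements are written as formal sums $\sum_{n\ge0}F_n$ with $F_n\in\mathbf{Sym}_n$. The internal product $FG$ is $\sum_n F_nG_n$, where $F_nG_n$ is the product in $\mathbb{Q}[\mathfrak{S}_n]$ (products of components of different degrees are $0$). The external product $\star$ is the bilinear, degree-additive product, extended to formal sums degree by degree, with $S^{(i_1,\dots,i_r)}\star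 S^{(j_1,\dots,j_s)}=S^{(i_1,\dots,i_r,j_1,\dots,j_s)}$; its unit is $S^{()}$, in degree $0$, and $F^{\star k}$ denotes powers for $\star$, with $F^{\star 0}=S^{()}$. Let $V_1^+=\sum_{n\ge0}R_{(n)}$ and $V_1^-=\sum_{n\ge0}R_{(1^n)}$ (for $n=0$ both compositions are empty) and, for $m\ge0$, define the alternating external products $$V_{2m}^+=(V_1^+\star V_1^-)^{\star m},\quad V_{2m}^-=(V_1^-\star V_1^+)^{\star m},\quad V_{2m+1}^+=V_1^+\star(V_1^-\star V_1^+)^{\star m},\quad V_{2m+1}^-=V_1^-\star(V_1^+\star V_1^-)^{\star m}.$$ Then for all integers $k,l\ge0$, under the internal product, $$V_k^+V_l^+=V_{kl}^+,\qquad V_k^-V_l^+=V_{kl}^-.$$ If $k$ is even, then $$V_k^+V_l^-=V_{kl}^+,\qquad V_k^-V_l^-=V_{kl}^-.$$ If $k$ is odd, then $$V_k^+V_l^-=V_{kl}^-,\qquad V_k^-V_l^-=V_{kl}^+.$$ -/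

import Mathlib

namespace NSym

/-- The descent set of a composition `I = (i_1, …, i_r)` of `n`: the set
`{i_1, i_1 + i_2, …, i_1 + ⋯ + i_{r-1}}`. -/
def compDes {n : ℕ} (I : Composition n) : Set ℕ :=
  {d | ∃ j : ℕ, 0 < j ∧ j < I.length ∧ I.sizeUpTo j = d}

/-- The descent set of a permutation: the `i` with `1 ≤ i ≤ n - 1` such that
`σ(i) > σ(i+1)`. The entries `σ(i)`, `σ(i+1)` of the word of `σ` are the values of `σ` at the
elements `i - 1`, `i` of `Fin n`, which is numbered from `0`. -/
def permDes {n : ℕ} (σ : Equiv.Perm (Fin n)) : Set ℕ :=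
  {i | ∃ (_ : 1 ≤ i) (h : i < n), σ ⟨i, h⟩ < σ ⟨i - 1, by omega⟩}

/-- The rational group algebra of the symmetric group on `n` letters. Multiplication of
permutations is composition, `(σ * τ) i = σ (τ i)`. -/
abbrev GroupAlg (n : ℕ) : Type := MonoidAlgebra ℚ (Equiv.Perm (Fin n))

open scoped Classical in
/-- `R_I`, the sum of the permutations whose descent set is `Des(I)`. -/
noncomputable def ribbon {n : ℕ} (I : Composition n) : GroupAlg n :=
  ∑ σ : Equiv.Perm (Fin n) with permDes σ = compDes I, MonoidAlgebra.single σ 1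

open scoped Classical in
/-- `S^I`, the sum of the permutations whose descent set is contained in `Des(I)`. -/
noncomputable def complete {n : ℕ} (I : Composition n) : GroupAlg n :=
  ∑ σ : Equiv.Perm (Fin n) with permDes σ ⊆ compDes I, MonoidAlgebra.single σ 1

/-- `Sym_n`, the descent algebra of degree `n`, as a vector space: the linear span of
the `R_I`. -/
noncomputable def descentAlg (n : ℕ) : Submodule ℚ (GroupAlg n) :=
  Submodule.span ℚ (Set.range (ribbon (n := n)))

/-! ### The elements `S^I` form a basis of `Sym_n` -/

theorem mem_compDes_iff {n : ℕ} (I : Composition n) (d : ℕ) :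
    d ∈ compDes I ↔ 0 < d ∧ d < n ∧ ∃ b ∈ I.boundaries, (b : ℕ) = d := by
  constructor
  · rintro ⟨j, hj0, hj, rfl⟩
    have h1 : I.sizeUpTo 0 < I.sizeUpTo j :=
      lt_of_lt_of_le (I.sizeUpTo_strict_mono (by omega)) (I.monotone_sizeUpTo hj0)
    have h2 : I.sizeUpTo j < I.sizeUpTo I.length :=
      lt_of_lt_of_le (I.sizeUpTo_strict_mono hj) (I.monotone_sizeUpTo hj)
    rw [I.sizeUpTo_zero] at h1
    rw [I.sizeUpTo_length] at h2
    refine ⟨h1, h2, I.boundary ⟨j, by omega⟩, ?_, rfl⟩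
    simp [Composition.boundaries]
  · rintro ⟨h0, hn, b, hb, rfl⟩
    simp only [Composition.boundaries, Finset.mem_map, Finset.mem_univ, true_and] at hb
    obtain ⟨⟨j, hj⟩, rfl⟩ := hb
    have hv : ((I.boundary.toEmbedding ⟨j, hj⟩ : Fin (n + 1)) : ℕ) = I.sizeUpTo j := rfl
    refine ⟨j, ?_, ?_, rfl⟩
    · rcases Nat.eq_zero_or_pos j with rfl | h
      · rw [hv, I.sizeUpTo_zero] at h0; omega
      · exact h
    · by_contra hc
      rw [hv, I.sizeUpTo_ofLength_le j (by omega)] at hn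
      omega

theorem compDes_injective {n : ℕ} : Function.Injective (compDes (n := n)) := by
  intro I J h
  apply (compositionEquiv n).injective
  apply CompositionAsSet.ext
  change I.boundaries = J.boundaries
  have key : ∀ (A B : Composition n), compDes A = compDes B →
      ∀ b ∈ A.boundaries, b ∈ B.boundaries := by
    intro A B hAB b hb
    have z (C : Composition n) : (0 : Fin (n + 1)) ∈ C.boundaries :=
      C.toCompositionAsSet.zero_mem
    have t (C : Composition n) : Fin.last n ∈ C.boundaries :=
      C.toCompositionAsSet.getLast_mem
    rcases Nat.eq_zero_or_pos (b : ℕ) with h0 | h0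
    · have : b = 0 := Fin.ext h0
      rw [this]; exact z B
    · rcases Nat.lt_or_ge (b : ℕ) n with hn | hn
      · have hm : (b : ℕ) ∈ compDes A := (mem_compDes_iff A _).2 ⟨h0, hn, b, hb, rfl⟩
        rw [hAB] at hm
        obtain ⟨_, _, c, hc, hcb⟩ := (mem_compDes_iff B _).1 hm
        rwa [← Fin.ext hcb]
      · have : b = Fin.last n := Fin.ext (by have := b.2; simp; omega)
        rw [this]; exact t B
  exact Finset.ext fun b => ⟨key I J h b, key J I h.symm b⟩

theorem exists_compDes_eq {n : ℕ} (A : Set ℕ) (hA : ∀ d ∈ A, 0 < d ∧ d < n) :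
    ∃ I : Composition n, compDes I = A := by
  classical
  let c : CompositionAsSet n :=
    { boundaries := Finset.univ.filter fun b : Fin (n + 1) =>
        b = 0 ∨ b = Fin.last n ∨ (b : ℕ) ∈ A
      zero_mem := by simp
      getLast_mem := by simp }
  refine ⟨c.toComposition, ?_⟩
  ext d
  rw [mem_compDes_iff, c.toComposition_boundaries]
  constructor
  · rintro ⟨h0, hn, b, hb, rfl⟩
    simp only [c, Finset.mem_filter, Finset.mem_univ, true_and] at hb
    rcases hb with rfl | rfl | hb
    · simp at h0
    · simp at hn
    · exact hb
  · intro hd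
    obtain ⟨h0, hn⟩ := hA d hd
    exact ⟨h0, hn, ⟨d, by omega⟩, by simp [c, hd], rfl⟩

theorem exists_compDes_eq_permDes {n : ℕ} (σ : Equiv.Perm (Fin n)) :
    ∃ I : Composition n, compDes I = permDes σ :=
  exists_compDes_eq _ fun _ ⟨h1, h2, _⟩ => ⟨h1, h2⟩

theorem exists_permDes_eq {n : ℕ} (A : Set ℕ) (hA : ∀ d ∈ A, 0 < d ∧ d < n) :
    ∃ σ : Equiv.Perm (Fin n), permDes σ = A := by
  classical
  -- positions are ranked first by decreasing block number, then from left to right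
  let cnt : ℕ → ℕ := fun i => ((Finset.range (i + 1)).filter (· ∈ A)).card
  let f : Fin n → ℤ := fun i => (i : ℤ) - (n : ℤ) * (cnt i : ℤ)
  have hmono : ∀ i j : ℕ, i ≤ j → cnt i ≤ cnt j := by
    intro i j hij
    apply Finset.card_le_card
    intro x hx
    simp only [Finset.mem_filter, Finset.mem_range] at hx ⊢
    exact ⟨by omega, hx.2⟩
  have hinj : Function.Injective f := by
    have key : ∀ i j : Fin n, i < j → f i ≠ f j := by
      intro i j hij he
      have h1 := hmono i j (le_of_lt hij)
      have hi := i.2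
      have hj := j.2
      have hij' : (i : ℕ) < j := hij
      simp only [f] at he
      rcases Nat.eq_or_lt_of_le h1 with h | h
      · rw [h] at he; omega
      · have : (n : ℤ) * (cnt i + 1) ≤ n * cnt j := by
          apply mul_le_mul_of_nonneg_left <;> omega
        rw [mul_add] at this
        omega
    intro i j he
    rcases lt_trichotomy i j with h | h | h
    · exact absurd he (key i j h)
    · exact h
    · exact absurd he.symm (key j i h)
  let σ : Equiv.Perm (Fin n) := (Tuple.sort f)⁻¹
  have hstrict : StrictMono (f ∘ Tuple.sort f) :=
    (Tuple.monotone_sort f).strictMono_of_injective (hinj.comp (Tuple.sort f).injective)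
  have hσ : ∀ i j : Fin n, σ i < σ j ↔ f i < f j := by
    intro i j
    have := hstrict.lt_iff_lt (a := σ i) (b := σ j)
    simpa [σ] using this.symm
  refine ⟨σ, ?_⟩
  ext i
  constructor
  · rintro ⟨h1, hn, hlt⟩
    rw [hσ] at hlt
    by_contra hi
    have : cnt i = cnt (i - 1) := by
      simp only [cnt]
      rw [Finset.range_add_one, Finset.filter_insert, if_neg hi]
      congr 2
      congr 1
      omega
    have hlt' : (i : ℤ) - n * cnt i < ((i - 1 : ℕ) : ℤ) - n * cnt (i - 1) := hlt
    rw [this] at hlt'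
    have : (i : ℤ) < ((i - 1 : ℕ) : ℤ) := by linarith
    omega
  · intro hi
    obtain ⟨h0, hn⟩ := hA i hi
    refine ⟨h0, hn, ?_⟩
    rw [hσ]
    have : cnt i = cnt (i - 1) + 1 := by
      simp only [cnt]
      rw [Finset.range_add_one, Finset.filter_insert, if_pos hi,
        Finset.card_insert_of_notMem (by simp), Nat.sub_add_cancel h0]
    simp only [f]
    rw [this]
    push_cast [Nat.cast_sub h0]
    have hn2 : (2 : ℤ) ≤ n := by omega
    linarith

theorem exists_permDes_eq_compDes {n : ℕ} (I : Composition n) :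
    ∃ σ : Equiv.Perm (Fin n), permDes σ = compDes I :=
  exists_permDes_eq _ fun d hd =>
    ⟨((mem_compDes_iff I d).1 hd).1, ((mem_compDes_iff I d).1 hd).2.1⟩

open scoped Classical in
theorem complete_eq_sum_ribbon {n : ℕ} (I : Composition n) :
    complete I = ∑ J : Composition n with compDes J ⊆ compDes I, ribbon J := by
  unfold complete ribbon
  rw [Finset.sum_sigma']
  symm
  refine Finset.sum_bij (fun x _ => x.2) ?_ ?_ ?_ ?_
  · rintro ⟨J, σ⟩ h
    simp only [Finset.mem_sigma, Finset.mem_filter, Finset.mem_univ, true_and] at h ⊢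
    rw [h.2]; exact h.1
  · rintro ⟨J, σ⟩ h ⟨J', σ'⟩ h' he
    simp only [Finset.mem_sigma, Finset.mem_filter, Finset.mem_univ, true_and] at h h' he
    subst he
    have : J = J' := compDes_injective (h.2.symm.trans h'.2)
    subst this
    rfl
  · intro σ h
    simp only [Finset.mem_filter, Finset.mem_univ, true_and] at h
    obtain ⟨J, hJ⟩ := exists_compDes_eq_permDes σ
    exact ⟨⟨J, σ⟩, by simp [hJ, h], rfl⟩
  · intros; rfl

theorem complete_mem {n : ℕ} (I : Composition n) : complete I ∈ descentAlg n := by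
  classical
  rw [complete_eq_sum_ribbon]
  exact Submodule.sum_mem _ fun J _ => Submodule.subset_span ⟨J, rfl⟩

theorem ribbon_mem {n : ℕ} (I : Composition n) : ribbon I ∈ descentAlg n :=
  Submodule.subset_span ⟨I, rfl⟩

open scoped Classical in
theorem complete_apply {n : ℕ} (I : Composition n) (σ : Equiv.Perm (Fin n)) :
    (complete I).coeff σ = if permDes σ ⊆ compDes I then 1 else 0 := by
  unfold complete
  rw [MonoidAlgebra.coeff_sum, Finsupp.finsetSum_apply]
  simp [Finsupp.single_apply, Finset.sum_ite_eq']

/-- `R_I` as an element of `Sym_n`. -/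
noncomputable def ribbonElt {n : ℕ} (I : Composition n) : descentAlg n :=
  ⟨ribbon I, ribbon_mem I⟩

/-- `S^I` as an element of `Sym_n`. -/
noncomputable def completeElt {n : ℕ} (I : Composition n) : descentAlg n :=
  ⟨complete I, complete_mem I⟩

theorem compDes_finite {n : ℕ} (I : Composition n) : (compDes I).Finite :=
  (Set.finite_lt_nat n).subset fun d hd => ((mem_compDes_iff I d).1 hd).2.1

theorem linearIndependent_complete (n : ℕ) :
    LinearIndependent ℚ (complete (n := n)) := by
  classical
  rw [Fintype.linearIndependent_iff]
  intro g hg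
  -- evaluation at a permutation with descent set `Des(J)`
  have heval : ∀ J : Composition n,
      ∑ I : Composition n, (if compDes J ⊆ compDes I then g I else 0) = 0 := by
    intro J
    obtain ⟨σ, hσ⟩ := exists_permDes_eq_compDes J
    have h := congrArg (fun x : GroupAlg n => x.coeff σ) hg
    simp only [MonoidAlgebra.coeff_sum, Finsupp.finsetSum_apply, MonoidAlgebra.coeff_smul,
      Finsupp.smul_apply, complete_apply, hσ, smul_eq_mul, mul_ite, mul_one, mul_zero,
      MonoidAlgebra.coeff_zero, Finsupp.zero_apply] at h
    exact h
  have hcard : ∀ J : Composition n, (compDes J).ncard ≤ n := by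
    intro J
    have hsub : compDes J ⊆ {d | d < n} := fun d hd => ((mem_compDes_iff J d).1 hd).2.1
    have := Set.ncard_le_ncard hsub (Set.finite_lt_nat n)
    have h2 : ({d | d < n} : Set ℕ).ncard = n := by
      rw [show ({d | d < n} : Set ℕ) = (Finset.range n : Set ℕ) by ext; simp,
        Set.ncard_coe_finset, Finset.card_range]
    omega
  have main : ∀ m : ℕ, ∀ J : Composition n, n - (compDes J).ncard = m → g J = 0 := by
    intro m
    induction m using Nat.strong_induction_on with
    | _ m ih =>
      intro J hJ
      have h := heval J
      rw [Finset.sum_eq_single J] at h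
      · simpa using h
      · intro I _ hIJ
        split_ifs with hsub
        · have hlt : (compDes J).ncard < (compDes I).ncard :=
            Set.ncard_lt_ncard
              (hsub.ssubset_of_ne fun he => hIJ (compDes_injective he.symm))
              (compDes_finite I)
          have := hcard I
          exact ih _ (by omega) I rfl
        · rfl
      · simp
  exact fun J => main _ J rfl

theorem linearIndependent_completeElt (n : ℕ) :
    LinearIndependent ℚ (completeElt (n := n)) :=
  LinearIndependent.of_comp (descentAlg n).subtype (linearIndependent_complete n)

theorem span_completeElt (n : ℕ) :
    ⊤ ≤ Submodule.span ℚ (Set.range (completeElt (n := n))) := by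
  have hle : Module.finrank ℚ (descentAlg n) ≤ Fintype.card (Composition n) :=
    finrank_range_le_card _
  have hge := (linearIndependent_completeElt n).fintype_card_le_finrank
  exact ((linearIndependent_completeElt n).span_eq_top_of_card_eq_finrank'
    (le_antisymm hge hle)).ge

/-- The basis `(S^I)` of `Sym_n`, indexed by the compositions `I` of `n`. -/
noncomputable def completeBasis (n : ℕ) : Module.Basis (Composition n) ℚ (descentAlg n) :=
  Module.Basis.mk (linearIndependent_completeElt n) (span_completeElt n)

theorem completeBasis_apply {n : ℕ} (I : Composition n) :
    completeBasis n I = completeElt I :=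
  Module.Basis.mk_apply _ _ I

/-! ### Completed noncommutative symmetric functions -/

/-- The completion of `Sym = ⨁ Sym_n`: its elements are the formal sums `∑_{n ≥ 0} F_n`
with `F_n ∈ Sym_n`. -/
abbrev CompletedSym : Type := ∀ n : ℕ, descentAlg n

/-- The external product `F ⋆ G`: the (bilinear, degree-additive) product given in the
basis `(S^I)` by concatenation of compositions, `S^I ⋆ S^J = S^{I·J}`. -/
noncomputable def extMul (F G : CompletedSym) : CompletedSym := fun n =>
  ∑ p : ↥(Finset.HasAntidiagonal.antidiagonal n), ∑ I : Composition p.1.1, ∑ J : Composition p.1.2,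
    ((completeBasis p.1.1).repr (F p.1.1) I * (completeBasis p.1.2).repr (G p.1.2) J) •
      completeElt ((I.append J).cast (Finset.HasAntidiagonal.mem_antidiagonal.1 p.2))

/-- The unit of the external product, `S_0 = 1`, in degree `0`
(`Composition.ones 0` is the empty composition). -/
noncomputable def extOne : CompletedSym := Pi.single 0 (completeElt (Composition.ones 0))

/-- Powers `F^{⋆ k}` for the external product. -/
noncomputable def extPow (F : CompletedSym) : ℕ → CompletedSym
  | 0 => extOne
  | k + 1 => extMul (extPow F k) F

/-- The internal product, degree by degree the product of the group algebra of the symmetric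
group, with products of components of different degrees equal to `0`. It is formed in
`∏ n, ℚ[𝔖_n]`, which contains `CompletedSym`. -/
noncomputable def intMul (F G : CompletedSym) : ∀ n : ℕ, GroupAlg n := fun n =>
  (F n : GroupAlg n) * (G n : GroupAlg n)

/-- The inclusion of `CompletedSym` in `∏ n, ℚ[𝔖_n]`. -/
def toGroupAlg (F : CompletedSym) : ∀ n : ℕ, GroupAlg n := fun n => (F n : GroupAlg n)

/-- The composition `(n)` of `n` with at most one part: it is empty for `n = 0`. -/
def onePart : (n : ℕ) → Composition n
  | 0 => Composition.ones 0
  | n + 1 => Composition.single (n + 1) n.succ_pos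

/-- `V_1^+ = ∑_{n ≥ 0} R_{(n)}`. -/
noncomputable def V1plus : CompletedSym := fun n => ribbonElt (onePart n)

/-- `V_1^- = ∑_{n ≥ 0} R_{(1^n)}`. -/
noncomputable def V1minus : CompletedSym := fun n => ribbonElt (Composition.ones n)

/-- `V_{2m}^+ = (V_1^+ ⋆ V_1^-)^{⋆ m}` and `V_{2m+1}^+ = V_1^+ ⋆ (V_1^- ⋆ V_1^+)^{⋆ m}`. -/
noncomputable def Vplus (k : ℕ) : CompletedSym :=
  if Even k then extPow (extMul V1plus V1minus) (k / 2)
  else extMul V1plus (extPow (extMul V1minus V1plus) (k / 2))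

/-- `V_{2m}^- = (V_1^- ⋆ V_1^+)^{⋆ m}` and `V_{2m+1}^- = V_1^- ⋆ (V_1^+ ⋆ V_1^-)^{⋆ m}`. -/
noncomputable def Vminus (k : ℕ) : CompletedSym :=
  if Even k then extPow (extMul V1minus V1plus) (k / 2)
  else extMul V1minus (extPow (extMul V1plus V1minus) (k / 2))

end NSym

namespace NSym

/-! ### Coefficients as functions of the descent set -/

/-! Both products become counts of maps. The coefficient of `σ` in an element of `Sym_n` depends
only on the descent set, and in these terms `⋆` is a convolution that cuts the positions into an
initial and a final segment, with no condition at the cut. Hence the coefficient of `σ` in an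
alternating product of `k` factors is the number of weakly increasing `f : Fin n → Fin k` (cuttings
into `k` possibly empty blocks) such that `σ` increases on the blocks of sign `1` and decreases on
those of sign `-1` (`coeffFun_altProd`). Equivalently, the positions are already sorted by the key
"block, then signed value of `σ`" (`adapted_permDes_iff`).

For the internal product, the coefficient of `π` counts triples `(τ, f, g)` with `f` sorting `π *
τ⁻¹` and `g` sorting `τ`. Put `φ = f ∘ τ`. The condition on `f` says that `τ` ranks the positions by
the key of `(φ, π)`, so `τ` is determined by `φ`. The condition on `g` then says that on its blocks
this key alternately increases and decreases. Reversing the key reverses both the order of the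
values of `φ` and the sign of each block, so the pairs `(g i, φ i)`, numbered boustrophedon, form
one map to `Fin (k * l)` whose blocks again alternate in sign (`altSign_snake`,
`blockKey_snake_lt_iff`). This is a bijection (`sum_card_mul_card`), and the parity of `k` enters
only through the sign of the first block. -/

theorem mem_compDes_append {p q n : ℕ} (h : p + q = n) (I : Composition p) (J : Composition q)
    (d : ℕ) : d ∈ compDes ((I.append J).cast h) ↔
      0 < d ∧ d < n ∧ (d ∈ compDes I ∨ d = p ∨ ∃ e ∈ compDes J, d = e + p) := by
  subst h
  rw [Composition.cast_rfl]
  have hlen : (I.append J).length = I.length + J.length := by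
    simp [Composition.length, Composition.append]
  have hsize (j : ℕ) : (I.append J).sizeUpTo j = I.sizeUpTo j + J.sizeUpTo (j - I.length) := by
    simp [Composition.sizeUpTo, Composition.append, List.take_append, Composition.length]
  constructor
  · intro hd
    obtain ⟨h0, hn, -⟩ := (mem_compDes_iff _ _).1 hd
    refine ⟨h0, hn, ?_⟩
    obtain ⟨j, hj0, hj, rfl⟩ := hd
    rw [hsize]
    rcases lt_trichotomy j I.length with hjl | rfl | hjl
    · left
      exact ⟨j, hj0, hjl, by rw [show j - I.length = 0 by omega]; simp⟩
    · right; left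
      simp
    · right; right
      refine ⟨_, ⟨j - I.length, by omega, by omega, rfl⟩, ?_⟩
      rw [I.sizeUpTo_ofLength_le j hjl.le, add_comm]
  · rintro ⟨h0, hn, ⟨j, hj0, hj, rfl⟩ | rfl | ⟨e, ⟨j, hj0, hj, rfl⟩, rfl⟩⟩
    · exact ⟨j, hj0, by omega, by rw [hsize, show j - I.length = 0 by omega]; simp⟩
    · have hI : 0 < I.length := I.length_pos_of_pos h0
      have hJ : 0 < J.length := J.length_pos_of_pos (by omega)
      exact ⟨I.length, hI, by omega, by rw [hsize]; simp⟩
    · refine ⟨j + I.length, by omega, by omega, ?_⟩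
      rw [hsize, I.sizeUpTo_ofLength_le _ (by omega), Nat.add_sub_cancel, add_comm]

/-- The cut `p` is always allowed as a descent of the concatenation, so only the conditions strictly
on either side remain. Intersecting with an open interval lets `A` be any set, so that shifting it
needs no truncation. -/
theorem inter_Ioo_subset_compDes_append {p q n : ℕ} (h : p + q = n) (I : Composition p)
    (J : Composition q) (A : Set ℕ) :
    A ∩ Set.Ioo 0 n ⊆ compDes ((I.append J).cast h) ↔
      A ∩ Set.Ioo 0 p ⊆ compDes I ∧ {d | d + p ∈ A} ∩ Set.Ioo 0 q ⊆ compDes J := by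
  have hI {d} (hd : d ∈ compDes I) : 0 < d ∧ d < p :=
    ⟨((mem_compDes_iff I d).1 hd).1, ((mem_compDes_iff I d).1 hd).2.1⟩
  have hJ {d} (hd : d ∈ compDes J) : 0 < d ∧ d < q :=
    ⟨((mem_compDes_iff J d).1 hd).1, ((mem_compDes_iff J d).1 hd).2.1⟩
  simp only [Set.subset_def, Set.mem_inter_iff, Set.mem_Ioo, Set.mem_ofPred_eq,
    mem_compDes_append]
  constructor
  · intro H
    refine ⟨fun d ⟨hd, h0, h1⟩ => ?_, fun d ⟨hd, h0, h1⟩ => ?_⟩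
    · obtain ⟨-, -, h' | h' | ⟨e, he, h'⟩⟩ := H d ⟨hd, by omega, by omega⟩
      · exact h'
      · omega
      · omega
    · obtain ⟨-, -, h' | h' | ⟨e, he, h'⟩⟩ := H (d + p) ⟨hd, by omega, by omega⟩
      · have := hI h'
        omega
      · omega
      · rwa [show d = e by omega]
  · rintro ⟨H1, H2⟩ d ⟨hd, h0, h1⟩
    refine ⟨h0, h1, ?_⟩
    rcases lt_trichotomy d p with hp | hp | hp
    · exact Or.inl (H1 d ⟨hd, h0, hp⟩)
    · exact Or.inr (Or.inl hp)
    · refine Or.inr (Or.inr ⟨d - p, H2 _ ⟨?_, by omega, by omega⟩, by omega⟩)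
      rwa [Nat.sub_add_cancel hp.le]

open scoped Classical in
/-- The linear functional on `Sym_n` that reads off the common coefficient of the permutations
whose descent set is the part of `A` between `0` and `n`. -/
noncomputable def desCoeff (n : ℕ) (A : Set ℕ) : descentAlg n →ₗ[ℚ] ℚ :=
  (completeBasis n).constr ℚ fun I => if A ∩ Set.Ioo 0 n ⊆ compDes I then 1 else 0

open scoped Classical in
theorem desCoeff_completeElt {n : ℕ} (A : Set ℕ) (I : Composition n) :
    desCoeff n A (completeElt I) = if A ∩ Set.Ioo 0 n ⊆ compDes I then 1 else 0 := by
  rw [← completeBasis_apply, desCoeff, Module.Basis.constr_basis]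

theorem desCoeff_eq_sum {n : ℕ} (A : Set ℕ) (x : descentAlg n) :
    desCoeff n A x =
      ∑ I, (completeBasis n).repr x I * desCoeff n A (completeElt I) := by
  conv_lhs => rw [← (completeBasis n).sum_repr x]
  simp [completeBasis_apply]

theorem permDes_subset_Ioo {n : ℕ} (σ : Equiv.Perm (Fin n)) : permDes σ ⊆ Set.Ioo 0 n :=
  fun _ ⟨h1, h2, _⟩ => ⟨h1, h2⟩

theorem coeff_eq_desCoeff {n : ℕ} {A : Set ℕ} {σ : Equiv.Perm (Fin n)}
    (hσ : permDes σ = A ∩ Set.Ioo 0 n) (x : descentAlg n) :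
    (x : GroupAlg n).coeff σ = desCoeff n A x := by
  conv_lhs => rw [← (completeBasis n).sum_repr x]
  rw [desCoeff_eq_sum]
  simp only [AddSubmonoidClass.coe_finsetSum, SetLike.val_smul, MonoidAlgebra.coeff_sum,
    Finsupp.finsetSum_apply, MonoidAlgebra.coeff_smul_apply, smul_eq_mul, completeBasis_apply]
  refine Finset.sum_congr rfl fun I _ => ?_
  rw [desCoeff_completeElt, ← hσ]
  exact congrArg _ (complete_apply I σ)

theorem coeff_eq_desCoeff_permDes {n : ℕ} (σ : Equiv.Perm (Fin n)) (x : descentAlg n) :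
    (x : GroupAlg n).coeff σ = desCoeff n (permDes σ) x :=
  coeff_eq_desCoeff (Set.inter_eq_left.2 (permDes_subset_Ioo σ)).symm x

-- Realising the truncated set as a descent set reads the value off as a coefficient of `R_I`; no
-- inversion between the two bases is needed.
open scoped Classical in
theorem desCoeff_ribbonElt {n : ℕ} (A : Set ℕ) (I : Composition n) :
    desCoeff n A (ribbonElt I) = if A ∩ Set.Ioo 0 n = compDes I then 1 else 0 := by
  obtain ⟨σ, hσ⟩ := exists_permDes_eq (n := n) (A ∩ Set.Ioo 0 n) fun d hd => hd.2
  rw [← coeff_eq_desCoeff hσ, ← hσ]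
  change (ribbon I).coeff σ = _
  unfold ribbon
  rw [MonoidAlgebra.coeff_sum, Finsupp.finsetSum_apply]
  simp [Finsupp.single_apply, Finset.sum_ite_eq']

/-! ### The external product as a convolution -/

/-- The coefficients of a formal sum, as a function of the degree and the descent set. -/
noncomputable def coeffFun (F : CompletedSym) (n : ℕ) (A : Set ℕ) : ℚ := desCoeff n A (F n)

/-- The convolution of functions of a degree and a descent set, which cuts `{1, …, n}` into an
initial and a final segment. -/
def conv (f g : ℕ → Set ℕ → ℚ) (n : ℕ) (A : Set ℕ) : ℚ :=
  ∑ p ∈ Finset.HasAntidiagonal.antidiagonal n, f p.1 A * g p.2 {d | d + p.1 ∈ A}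

/-- The unit of `conv`. -/
def convOne (n : ℕ) (_ : Set ℕ) : ℚ := if n = 0 then 1 else 0

theorem conv_assoc (f g h : ℕ → Set ℕ → ℚ) : conv (conv f g) h = conv f (conv g h) := by
  funext n A
  simp only [conv, Finset.sum_mul, Finset.mul_sum, Finset.sum_sigma']
  refine Finset.sum_nbij' (fun x => ⟨(x.2.1, x.2.2 + x.1.2), (x.2.2, x.1.2)⟩)
    (fun x => ⟨(x.1.1 + x.2.1, x.2.2), (x.1.1, x.2.1)⟩) ?_ ?_ ?_ ?_ ?_
  · rintro ⟨⟨a, b⟩, ⟨c, d⟩⟩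
    simp only [Finset.mem_sigma, Finset.HasAntidiagonal.mem_antidiagonal]
    rintro ⟨rfl, rfl⟩
    exact ⟨(add_assoc c d b).symm, trivial⟩
  · rintro ⟨⟨a, b⟩, ⟨c, d⟩⟩
    simp only [Finset.mem_sigma, Finset.HasAntidiagonal.mem_antidiagonal]
    rintro ⟨rfl, rfl⟩
    exact ⟨add_assoc a c d, trivial⟩
  · rintro ⟨⟨a, b⟩, ⟨c, d⟩⟩
    simp only [Finset.mem_sigma, Finset.HasAntidiagonal.mem_antidiagonal]
    rintro ⟨-, rfl⟩
    rfl
  · rintro ⟨⟨a, b⟩, ⟨c, d⟩⟩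
    simp only [Finset.mem_sigma, Finset.HasAntidiagonal.mem_antidiagonal]
    rintro ⟨-, rfl⟩
    rfl
  · rintro ⟨⟨a, b⟩, ⟨c, d⟩⟩
    simp only [Finset.mem_sigma, Finset.HasAntidiagonal.mem_antidiagonal]
    rintro ⟨-, rfl⟩
    simp only [Set.mem_ofPred_eq, mul_assoc, add_assoc, add_comm d c]

theorem conv_one (f : ℕ → Set ℕ → ℚ) : conv f convOne = f := by
  funext n A
  rw [conv, Finset.sum_eq_single (n, 0)]
  · simp [convOne]
  · rintro ⟨a, b⟩ hab hne
    have : b ≠ 0 := by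
      rintro rfl
      simp_all
    simp [convOne, this]
  · simp

theorem one_conv (f : ℕ → Set ℕ → ℚ) : conv convOne f = f := by
  funext n A
  rw [conv, Finset.sum_eq_single (0, n)]
  · simp [convOne]
  · rintro ⟨a, b⟩ hab hne
    have : a ≠ 0 := by
      rintro rfl
      simp_all
    simp [convOne, this]
  · simp

theorem coeffFun_extMul (F G : CompletedSym) :
    coeffFun (extMul F G) = conv (coeffFun F) (coeffFun G) := by
  classical
  funext n A
  simp only [coeffFun, extMul, conv, map_sum, map_smul]
  rw [← Finset.sum_coe_sort (Finset.HasAntidiagonal.antidiagonal n)]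
  refine Finset.sum_congr rfl fun p _ => ?_
  rw [desCoeff_eq_sum A (F _), desCoeff_eq_sum _ (G _), Finset.sum_mul_sum]
  refine Finset.sum_congr rfl fun I _ => Finset.sum_congr rfl fun J _ => ?_
  rw [desCoeff_completeElt, desCoeff_completeElt, desCoeff_completeElt, smul_eq_mul,
    mul_mul_mul_comm, ite_zero_mul_ite_zero, mul_one]
  congr 1
  exact if_congr (inter_Ioo_subset_compDes_append _ I J A) rfl rfl

theorem coeffFun_extOne : coeffFun extOne = convOne := by
  funext n A
  rcases eq_or_ne n 0 with rfl | hn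
  · simp [coeffFun, extOne, convOne, desCoeff_completeElt]
  · simp [coeffFun, extOne, convOne, hn]

/-- Powers grow on the right by definition, whereas the recursion on the number of factors removes
the leftmost one; associativity of the convolution exchanges the two. -/
theorem coeffFun_extPow_succ (F : CompletedSym) (k : ℕ) :
    coeffFun (extPow F (k + 1)) = conv (coeffFun F) (coeffFun (extPow F k)) := by
  induction k with
  | zero => simp only [extPow, coeffFun_extMul, coeffFun_extOne, one_conv, conv_one]
  | succ k ih => rw [extPow, coeffFun_extMul, ih, conv_assoc, ← ih, extPow, coeffFun_extMul]

open scoped Classical in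
/-- The coefficients of `V_1^±`: the value is `1` if all positions are ascents (for the sign `1`)
or descents (for the sign `-1`). -/
noncomputable def monoBlock (u : ℤˣ) (n : ℕ) (A : Set ℕ) : ℚ :=
  if ∀ d, 0 < d → d < n → (d ∈ A ↔ u = -1) then 1 else 0

theorem compDes_onePart (n : ℕ) : compDes (onePart n) = ∅ := by
  ext d
  simp only [Set.mem_empty_iff_false, iff_false]
  rintro ⟨j, hj0, hj, -⟩
  cases n <;> simp [onePart] at hj; omega

theorem compDes_ones (n : ℕ) : compDes (Composition.ones n) = Set.Ioo 0 n := by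
  ext d
  constructor
  · intro h
    exact ⟨((mem_compDes_iff _ d).1 h).1, ((mem_compDes_iff _ d).1 h).2.1⟩
  · rintro ⟨h0, hn⟩
    exact ⟨d, h0, by simpa using hn, by simpa using hn.le⟩

theorem coeffFun_V1plus : coeffFun V1plus = monoBlock 1 := by
  classical
  funext n A
  rw [coeffFun, V1plus, desCoeff_ribbonElt, compDes_onePart, monoBlock]
  refine if_congr ?_ rfl rfl
  simp only [Set.ext_iff, Set.mem_inter_iff, Set.mem_Ioo, Set.mem_empty_iff_false, iff_false,
    show ¬ (1 : ℤˣ) = -1 by decide]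
  exact forall_congr' fun d => by tauto

theorem coeffFun_V1minus : coeffFun V1minus = monoBlock (-1) := by
  classical
  funext n A
  rw [coeffFun, V1minus, desCoeff_ribbonElt, compDes_ones, monoBlock]
  refine if_congr ?_ rfl rfl
  simp only [Set.ext_iff, Set.mem_inter_iff, Set.mem_Ioo, iff_true]
  exact forall_congr' fun d => by tauto

/-- `V_k^+` for the sign `1` and `V_k^-` for the sign `-1`. -/
noncomputable def altProd (u : ℤˣ) (k : ℕ) : CompletedSym :=
  if u = 1 then Vplus k else Vminus k

theorem coeffFun_altProd_zero (u : ℤˣ) : coeffFun (altProd u 0) = convOne := by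
  rw [altProd]
  split_ifs <;> simp [Vplus, Vminus, extPow, coeffFun_extOne]

theorem coeffFun_altProd_succ (u : ℤˣ) (k : ℕ) :
    coeffFun (altProd u (k + 1)) = conv (monoBlock u) (coeffFun (altProd (-u) k)) := by
  rcases Nat.even_or_odd' k with ⟨m, rfl | rfl⟩
  · have h1 : ¬ Even (2 * m + 1) := by simp
    have h2 : (2 * m + 1) / 2 = m := by omega
    rcases Int.units_eq_one_or u with rfl | rfl
    · simp [altProd, Vplus, Vminus, h1, h2, coeffFun_extMul, coeffFun_V1plus,
        show ¬ (-1 : ℤˣ) = 1 by decide]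
    · simp [altProd, Vplus, Vminus, h1, h2, coeffFun_extMul, coeffFun_V1minus,
        show ¬ (-1 : ℤˣ) = 1 by decide]
  -- For an even number of factors the first one sits inside a power and has to be split off.
  · have h1 : ¬ Even (2 * m + 1) := by simp
    have h2 : (2 * m + 1) / 2 = m := by omega
    have h3 : Even (2 * m + 1 + 1) := ⟨m + 1, by omega⟩
    have h4 : (2 * m + 1 + 1) / 2 = m + 1 := by omega
    rcases Int.units_eq_one_or u with rfl | rfl
    · simp only [altProd, Vplus, Vminus, h1, h2, h3, h4, coeffFun_extMul, coeffFun_V1plus,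
        coeffFun_V1minus, coeffFun_extPow_succ, conv_assoc, if_true, if_false,
        show ¬ (-1 : ℤˣ) = 1 by decide]
    · simp only [altProd, Vplus, Vminus, h1, h2, h3, h4, coeffFun_extMul, coeffFun_V1plus,
        coeffFun_V1minus, coeffFun_extPow_succ, conv_assoc, if_true, if_false, neg_neg,
        show ¬ (-1 : ℤˣ) = 1 by decide]


/-! ### Coefficients of the alternating products as numbers of monotone maps -/

/-- The sign of the factor number `c` in an alternating product with initial sign `u`. -/
def altSign (u : ℤˣ) (c : ℕ) : ℤˣ := u * (-1) ^ c

theorem altSign_succ (u : ℤˣ) (c : ℕ) : altSign u (c + 1) = altSign (-u) c := by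
  simp [altSign, pow_succ]

/-- The map `f` cuts the positions into `k` consecutive blocks, on each of which `A` has the
behaviour prescribed by the sign of the block. -/
def Adapted {n k : ℕ} (u : ℤˣ) (A : Set ℕ) (f : Fin n → Fin k) : Prop :=
  ∀ (i : ℕ) (h : i + 1 < n), f ⟨i, by omega⟩ < f ⟨i + 1, h⟩ ∨
    (f ⟨i, by omega⟩ = f ⟨i + 1, h⟩ ∧ (i + 1 ∈ A ↔ altSign u (f ⟨i, by omega⟩) = -1))

theorem strictMono_of_lt_next {n : ℕ} {α : Type*} [Preorder α] {f : Fin n → α}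
    (hf : ∀ (i : ℕ) (h : i + 1 < n), f ⟨i, by omega⟩ < f ⟨i + 1, h⟩) : StrictMono f := by
  cases n with
  | zero => exact fun i => i.elim0
  | succ n => exact Fin.strictMono_iff_lt_succ.2 fun i => hf i (by omega)

theorem Adapted.monotone {n k : ℕ} {u : ℤˣ} {A : Set ℕ} {f : Fin n → Fin k}
    (hf : Adapted u A f) : Monotone f := by
  cases n with
  | zero => exact fun i => i.elim0
  | succ n =>
    exact Fin.monotone_iff_le_succ.2 fun i => (hf i (by omega)).elim le_of_lt fun h => h.1.le

/-- The map that is `0` at the first `p` positions and then continues with the values of `f`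
increased by `1`. -/
def prependZeros {n p q k : ℕ} (h : p + q = n) (f : Fin q → Fin k) (i : Fin n) : Fin (k + 1) :=
  if hi : (i : ℕ) < p then 0 else (f ⟨i - p, by omega⟩).succ

/-- Where the first block ends the map jumps strictly, which leaves membership of `p` in `A` free,
just as in `conv`. The remaining blocks are numbered one lower, hence the sign `-u`. -/
theorem adapted_prependZeros {n p q k : ℕ} (h : p + q = n) (u : ℤˣ) (A : Set ℕ)
    (f : Fin q → Fin k) : Adapted u A (prependZeros h f) ↔
      (∀ d, 0 < d → d < p → (d ∈ A ↔ u = -1)) ∧ Adapted (-u) {d | d + p ∈ A} f := by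
  subst h
  constructor
  · intro H
    refine ⟨fun d h0 hp => ?_, fun i hi => ?_⟩
    · obtain ⟨d, rfl⟩ := Nat.exists_eq_succ_of_ne_zero h0.ne'
      have := H d (by omega)
      simpa [prependZeros, show d < p by omega, show d + 1 < p by omega, altSign] using this
    · have := H (i + p) (by omega)
      have e : i + p + 1 - p = i + 1 := by omega
      simpa [prependZeros, show ¬ i + p < p by omega, show ¬ i + p + 1 < p by omega, e,
        altSign_succ, show i + 1 + p = i + p + 1 by omega] using this
  · rintro ⟨H1, H2⟩ i hi
    rcases lt_trichotomy (i + 1) p with hp | hp | hp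
    · have := H1 (i + 1) (by omega) hp
      simpa [prependZeros, show i < p by omega, hp, altSign] using this
    · left
      simp [prependZeros, show i < p by omega, show ¬ i + 1 < p by omega]
    · obtain ⟨j, rfl⟩ := Nat.exists_eq_add_of_le' (show p ≤ i by omega)
      have := H2 j (by omega)
      have e : j + p + 1 - p = j + 1 := by omega
      simpa [prependZeros, show ¬ j + p < p by omega, show ¬ j + p + 1 < p by omega, e,
        altSign_succ, show j + 1 + p = j + p + 1 by omega] using this

theorem prependZeros_injective {n p q k : ℕ} (h : p + q = n) :
    Function.Injective (prependZeros (k := k) h) := by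
  intro f g hfg
  funext j
  have := congrFun hfg ⟨j + p, by omega⟩
  simpa [prependZeros] using this

/-- The number of positions where a map takes the value `0`. -/
def zeroCount {n k : ℕ} (f : Fin n → Fin (k + 1)) : ℕ :=
  (Finset.univ.filter fun i => f i = 0).card

theorem zeroCount_le {n k : ℕ} (f : Fin n → Fin (k + 1)) : zeroCount f ≤ n :=
  (Finset.card_filter_le _ _).trans_eq (by simp)

theorem eq_zero_iff_lt_zeroCount {n k : ℕ} {f : Fin n → Fin (k + 1)} (hf : Monotone f)
    (i : Fin n) : f i = 0 ↔ (i : ℕ) < zeroCount f := by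
  constructor
  · intro h
    have : (Finset.Iic i).card ≤ zeroCount f := by
      refine Finset.card_le_card fun j hj => ?_
      have := hf (Finset.mem_Iic.1 hj)
      rw [h] at this
      simpa using this
    rw [Fin.card_Iic] at this
    omega
  · intro h
    by_contra h0
    have : zeroCount f ≤ (Finset.Iio i).card := by
      refine Finset.card_le_card fun j hj => ?_
      rw [Finset.mem_Iio]
      by_contra hij
      have := hf (not_lt.1 hij)
      rw [(Finset.mem_filter.1 hj).2] at this
      exact h0 (by simpa using this)
    rw [Fin.card_Iio] at this
    omega

theorem zeroCount_prependZeros {n p q k : ℕ} (h : p + q = n) (f : Fin q → Fin k) :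
    zeroCount (prependZeros h f) = p := by
  have : (Finset.univ.filter fun i => prependZeros h f i = 0) =
      Finset.univ.filter fun i : Fin n => (i : ℕ) < p := by
    refine Finset.filter_congr fun i _ => ?_
    unfold prependZeros
    split_ifs with hi <;> simp [hi]
  rw [zeroCount, this, Fin.card_filter_val_lt]
  omega

theorem exists_eq_prependZeros {n p q k : ℕ} (h : p + q = n) {f : Fin n → Fin (k + 1)}
    (hf : Monotone f) (hp : zeroCount f = p) : ∃ g : Fin q → Fin k, prependZeros h g = f := by
  refine ⟨fun j => (f ⟨j + p, by omega⟩).pred fun h0 => ?_, ?_⟩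
  · have := (eq_zero_iff_lt_zeroCount hf _).1 h0
    simp only at this
    omega
  · funext i
    unfold prependZeros
    split_ifs with hi
    · exact ((eq_zero_iff_lt_zeroCount hf i).2 (by omega)).symm
    · rw [Fin.succ_pred]
      congr 1
      ext
      simp only
      omega

-- Induction on the number of blocks: grouping the maps by the size `p` of their zero block matches
-- the summands of the convolution, since a monotone map is zero exactly on an initial segment.
open scoped Classical in
theorem coeffFun_altProd (u : ℤˣ) (k n : ℕ) (A : Set ℕ) :
    coeffFun (altProd u k) n A =
      (Finset.univ.filter fun f : Fin n → Fin k => Adapted u A f).card := by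
  induction k generalizing u n A with
  | zero =>
    rw [coeffFun_altProd_zero, convOne]
    rcases n with _ | n
    -- With no blocks there is one map in degree `0` and none in positive degree, as `convOne`
    -- requires.
    · have : ∀ f : Fin 0 → Fin 0, Adapted u A f := fun f i h => by omega
      simp [this]
    · simp
  | succ k ih =>
    rw [coeffFun_altProd_succ, conv]
    rw [Finset.card_eq_sum_card_fiberwise (t := Finset.HasAntidiagonal.antidiagonal n)
      (f := fun f => (zeroCount f, n - zeroCount f))]
    · rw [Nat.cast_sum]
      refine Finset.sum_congr rfl fun ⟨p, q⟩ hpq => ?_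
      have h : p + q = n := Finset.HasAntidiagonal.mem_antidiagonal.1 hpq
      rw [ih, monoBlock]
      dsimp only
      split_ifs with hb
      · rw [one_mul, ← Finset.card_image_of_injective _ (prependZeros_injective h)]
        congr 2
        ext f
        simp only [Finset.mem_image, Finset.mem_filter, Finset.mem_univ, true_and, Prod.mk.injEq]
        constructor
        · rintro ⟨g, hg, rfl⟩
          refine ⟨(adapted_prependZeros h u A g).2 ⟨hb, hg⟩, ?_⟩
          rw [zeroCount_prependZeros]
          omega
        · rintro ⟨hf, hp, -⟩
          obtain ⟨g, rfl⟩ := exists_eq_prependZeros h hf.monotone hp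
          exact ⟨g, ((adapted_prependZeros h u A g).1 hf).2, rfl⟩
      · rw [zero_mul, eq_comm, Nat.cast_eq_zero, Finset.card_eq_zero,
          Finset.eq_empty_iff_forall_notMem]
        intro f hf
        simp only [Finset.mem_filter, Finset.mem_univ, true_and, Prod.mk.injEq] at hf
        obtain ⟨hf, hp, -⟩ := hf
        obtain ⟨g, rfl⟩ := exists_eq_prependZeros h hf.monotone hp
        exact hb ((adapted_prependZeros h u A g).1 hf).1
    · intro f _
      have := zeroCount_le f
      exact Finset.HasAntidiagonal.mem_antidiagonal.2 (by dsimp only; omega)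

/-! ### Adapted maps as sorted keys -/

/-- Positions are compared by the block containing them and then by the value of `σ`, with the
order on the values reversed in the blocks of sign `-1`. -/
def blockKey {n k : ℕ} (u : ℤˣ) (σ : Equiv.Perm (Fin n)) (f : Fin n → Fin k) (i : Fin n) :
    Fin k ×ₗ ℤ :=
  toLex (f i, (altSign u (f i) : ℤ) * (σ i : ℤ))

theorem blockKey_lt_iff {n k : ℕ} (u : ℤˣ) (σ : Equiv.Perm (Fin n)) (f : Fin n → Fin k)
    (i j : Fin n) : blockKey u σ f i < blockKey u σ f j ↔
      f i < f j ∨ (f i = f j ∧ if altSign u (f i) = 1 then σ i < σ j else σ j < σ i) := by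
  rw [blockKey, blockKey, Prod.Lex.toLex_lt_toLex]
  refine or_congr_right (and_congr_right fun h => ?_)
  have h' : f i = f j := h
  simp only [← h']
  rcases Int.units_eq_one_or (altSign u (f i)) with hs | hs
  · simp [hs]
  · simp [hs, show ¬ (-1 : ℤˣ) = 1 by decide]

theorem blockKey_injective {n k : ℕ} (u : ℤˣ) (σ : Equiv.Perm (Fin n)) (f : Fin n → Fin k) :
    Function.Injective (blockKey u σ f) := by
  intro i j h
  have h1 : f i = f j := congrArg (fun x => (ofLex x).1) h
  have h2 : (altSign u (f i) : ℤ) * (σ i : ℤ) = (altSign u (f j) : ℤ) * (σ j : ℤ) :=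
    congrArg (fun x => (ofLex x).2) h
  rw [h1] at h2
  have h3 := mul_left_cancel₀ (Units.ne_zero _) h2
  exact σ.injective (Fin.ext (by exact_mod_cast h3))

/-- Both conditions concern neighbouring positions only, and there an ascent of `σ` is the same as
no descent because `σ` is injective. -/
theorem adapted_permDes_iff {n k : ℕ} (u : ℤˣ) (σ : Equiv.Perm (Fin n)) (f : Fin n → Fin k) :
    Adapted u (permDes σ) f ↔ StrictMono (blockKey u σ f) := by
  have key : ∀ (i : ℕ) (h : i + 1 < n),
      (i + 1 ∈ permDes σ ↔ altSign u (f ⟨i, by omega⟩) = -1) ↔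
        if altSign u (f ⟨i, by omega⟩) = 1 then σ ⟨i, by omega⟩ < σ ⟨i + 1, h⟩
        else σ ⟨i + 1, h⟩ < σ ⟨i, by omega⟩ := by
    intro i h
    have hmem : i + 1 ∈ permDes σ ↔ σ ⟨i + 1, h⟩ < σ ⟨i, by omega⟩ :=
      ⟨fun ⟨_, _, h'⟩ => h', fun h' => ⟨by omega, h, h'⟩⟩
    have hne : σ ⟨i, by omega⟩ ≠ σ ⟨i + 1, h⟩ := fun he => by
      simpa using σ.injective he
    rw [hmem]
    rcases Int.units_eq_one_or (altSign u (f ⟨i, by omega⟩)) with hs | hs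
    · simp [hs, show ¬ (1 : ℤˣ) = -1 by decide, hne.le_iff_lt]
    · simp [hs, show ¬ (-1 : ℤˣ) = 1 by decide]
  constructor
  · intro H
    refine strictMono_of_lt_next fun i h => ?_
    rw [blockKey_lt_iff]
    exact (H i h).imp id fun h' => ⟨h'.1, (key i h).1 h'.2⟩
  · intro H i h
    have := H (show (⟨i, by omega⟩ : Fin n) < ⟨i + 1, h⟩ from Nat.lt_succ_self i)
    rw [blockKey_lt_iff] at this
    exact this.imp id fun h' => ⟨h'.1, (key i h).2 h'.2⟩

open scoped Classical in
theorem coeff_altProd (u : ℤˣ) (k : ℕ) {n : ℕ} (σ : Equiv.Perm (Fin n)) :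
    (altProd u k n : GroupAlg n).coeff σ =
      (Finset.univ.filter fun f : Fin n → Fin k => StrictMono (blockKey u σ f)).card := by
  rw [coeff_eq_desCoeff_permDes]
  refine (coeffFun_altProd u k n (permDes σ)).trans ?_
  simp only [adapted_permDes_iff]


/-! ### Internal products -/

/-- The numbering of the pairs `(j, c)` by blocks of size `k`, each block numbered upwards or
downwards according to the sign of `j`. -/
def snake {k l : ℕ} (t : ℤˣ) (j : Fin l) (c : Fin k) : Fin (k * l) :=
  finProdFinEquiv (j, if altSign t j = 1 then c else c.rev) |>.cast (mul_comm l k)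

theorem snake_val {k l : ℕ} (t : ℤˣ) (j : Fin l) (c : Fin k) :
    (snake t j c : ℕ) = (if altSign t j = 1 then c else c.rev : Fin k) + k * j := by
  simp [snake, finProdFinEquiv]

theorem snake_lt_snake_of_lt {k l : ℕ} (t : ℤˣ) {j j' : Fin l} (h : j < j') (c c' : Fin k) :
    snake t j c < snake t j' c' := by
  rw [Fin.lt_def, snake_val, snake_val]
  have h1 : k * ((j : ℕ) + 1) ≤ k * j' := Nat.mul_le_mul_left k h
  have h2 := (if altSign t j = 1 then c else c.rev : Fin k).2
  rw [mul_add] at h1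
  omega

theorem snake_lt_snake_iff {k l : ℕ} (t : ℤˣ) (j : Fin l) (c c' : Fin k) :
    snake t j c < snake t j c' ↔ if altSign t j = 1 then c < c' else c' < c := by
  rw [Fin.lt_def, snake_val, snake_val]
  split_ifs
  · simp
  · simp only [add_lt_add_iff_right, ← Fin.lt_def, Fin.rev_lt_rev]

theorem exists_snake_eq {k l : ℕ} (t : ℤˣ) (m : Fin (k * l)) :
    ∃ (j : Fin l) (c : Fin k), snake t j c = m := by
  obtain ⟨⟨j, c⟩, h⟩ := finProdFinEquiv.surjective (m.cast (mul_comm k l))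
  refine ⟨j, if altSign t j = 1 then c else c.rev, ?_⟩
  unfold snake
  split_ifs <;> simp [h]

theorem snake_inj {k l : ℕ} (t : ℤˣ) {j j' : Fin l} {c c' : Fin k} :
    snake t j c = snake t j' c' ↔ j = j' ∧ c = c' := by
  constructor
  · intro h
    rcases lt_trichotomy j j' with hj | rfl | hj
    · exact absurd h (snake_lt_snake_of_lt t hj c c').ne
    · have h1 := (snake_lt_snake_iff t j c c').not.1 h.not_lt
      have h2 := (snake_lt_snake_iff t j c' c).not.1 h.symm.not_lt
      split_ifs at h1 h2 <;> exact ⟨rfl, le_antisymm (by order) (by order)⟩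
    · exact absurd h (snake_lt_snake_of_lt t hj c' c).ne'
  · rintro ⟨rfl, rfl⟩
    rfl

/-- The initial sign of the internal product of the alternating products with `k` factors and
initial sign `u` and with initial sign `t`. -/
def prodSign (k : ℕ) (u t : ℤˣ) : ℤˣ := if Even k then u else u * t

/-- The offset `k * j` contributes `(-1) ^ (k * j)`, and reversal replaces `c` by `k - 1 - c`. For
even `k` the offset is invisible and reversal flips the sign; for odd `k` reversal preserves parity
and the offset gives `(-1) ^ j`, so the factor `t` has to come from the initial sign. -/
theorem altSign_snake {k l : ℕ} (u t : ℤˣ) (j : Fin l) (c : Fin k) :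
    altSign (prodSign k u t) (snake t j c) = altSign t j * altSign u c := by
  -- The exponent `k + 1` stands for `k - 1`, which has the same parity.
  have hrev : ((-1 : ℤˣ)) ^ (c.rev : ℕ) = (-1) ^ (k + 1) * (-1) ^ (c : ℕ) := by
    have h : ((-1 : ℤˣ)) ^ (c.rev : ℕ) * (-1) ^ ((c : ℕ) + 1) = (-1) ^ k := by
      rw [← pow_add, Fin.val_rev]
      congr 1
      omega
    rw [pow_succ', ← h, pow_succ', mul_assoc, mul_assoc, mul_assoc, ← pow_add, ← two_mul,
      pow_mul]
    simp
  rw [snake_val]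
  unfold altSign prodSign
  have hs : t * (-1) ^ (j : ℕ) = 1 ∨ t * (-1) ^ (j : ℕ) = -1 := Int.units_eq_one_or _
  rcases Nat.even_or_odd k with hk | hk
  · rw [if_pos hk, pow_add, (hk.mul_right _).neg_one_pow]
    rcases hs with hs | hs
    · simp [hs]
    · simp [hs, show ¬ (-1 : ℤˣ) = 1 by decide, -Fin.val_rev, hrev, pow_succ, hk.neg_one_pow]
  · rw [if_neg (Nat.not_even_iff_odd.2 hk), pow_add, pow_mul, hk.neg_one_pow,
      show ∀ x : ℤˣ, u * t * (x * (-1) ^ (j : ℕ)) = t * (-1) ^ (j : ℕ) * (u * x) by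
        intro x; ac_rfl]
    rcases hs with hs | hs
    · simp [hs]
    · simp [hs, show ¬ (-1 : ℤˣ) = 1 by decide, -Fin.val_rev, hrev, pow_succ, hk.neg_one_pow]

/-- In a block of `g` of sign `-1` the numbering of the values of `φ` is reversed and every inner
sign changes, so the two levels of the key of `(φ, π)` are reversed together. -/
theorem blockKey_snake_lt_iff {n k l : ℕ} (u t : ℤˣ) (π : Equiv.Perm (Fin n)) (g : Fin n → Fin l)
    (φ : Fin n → Fin k) (i i' : Fin n) :
    blockKey (prodSign k u t) π (fun i => snake t (g i) (φ i)) i <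
        blockKey (prodSign k u t) π (fun i => snake t (g i) (φ i)) i' ↔
      g i < g i' ∨ (g i = g i' ∧ if altSign t (g i) = 1 then blockKey u π φ i < blockKey u π φ i'
        else blockKey u π φ i' < blockKey u π φ i) := by
  simp only [blockKey_lt_iff, altSign_snake, snake_inj]
  rcases lt_trichotomy (g i) (g i') with h | h | h
  · simp [h, snake_lt_snake_of_lt t h]
  · rw [← h, snake_lt_snake_iff]
    rcases lt_trichotomy (φ i) (φ i') with h' | h' | h'
    · simp [h', h'.ne, h'.ne', h'.not_gt]
    · rw [← h']
      rcases Int.units_eq_one_or (altSign t (g i)) with h1 | h1 <;>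
      rcases Int.units_eq_one_or (altSign u (φ i)) with h2 | h2 <;>
      simp [h1, h2, show ¬ (-1 : ℤˣ) = 1 by decide]
    · simp [h', h'.ne, h'.ne', h'.not_gt]
  · simp [h.not_gt, h.ne', (snake_lt_snake_of_lt t h (φ i') (φ i)).not_gt]

/-- By `hτ`, the permutation `τ` ranks the positions by the key of `(φ, π)`, so comparing keys is
comparing values of `τ`. -/
theorem strictMono_blockKey_snake_iff {n k l : ℕ} (u t : ℤˣ) (π τ : Equiv.Perm (Fin n))
    (g : Fin n → Fin l) (φ : Fin n → Fin k) (hτ : StrictMono (blockKey u π φ ∘ ⇑τ⁻¹)) :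
    StrictMono (blockKey (prodSign k u t) π fun i => snake t (g i) (φ i)) ↔
      StrictMono (blockKey t τ g) := by
  have hlt : ∀ i i', blockKey u π φ i < blockKey u π φ i' ↔ τ i < τ i' := by
    intro i i'
    simpa using hτ.lt_iff_lt (a := τ i) (b := τ i')
  refine forall_congr' fun i => forall_congr' fun i' => imp_congr_right fun _ => ?_
  rw [blockKey_snake_lt_iff, hlt, hlt, blockKey_lt_iff]

theorem blockKey_mul_inv {n k : ℕ} (u : ℤˣ) (π τ : Equiv.Perm (Fin n)) (f : Fin n → Fin k) :
    blockKey u (π * τ⁻¹) f = blockKey u π (f ∘ τ) ∘ ⇑τ⁻¹ := by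
  funext i
  simp [blockKey]

open scoped Classical in
theorem sum_card_mul_card (u t : ℤˣ) (k l : ℕ) {n : ℕ} (π : Equiv.Perm (Fin n)) :
    ∑ τ : Equiv.Perm (Fin n),
      (Finset.univ.filter fun f : Fin n → Fin k => StrictMono (blockKey u (π * τ⁻¹) f)).card *
      (Finset.univ.filter fun g : Fin n → Fin l => StrictMono (blockKey t τ g)).card =
    (Finset.univ.filter fun h : Fin n → Fin (k * l) =>
      StrictMono (blockKey (prodSign k u t) π h)).card := by
  simp only [← Finset.card_product]
  rw [← Finset.card_sigma]
  refine Finset.card_bij (fun x _ i => snake t (x.2.2 i) (x.2.1 (x.1 i))) ?_ ?_ ?_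
  · rintro ⟨τ, f, g⟩ h
    simp only [Finset.mem_sigma, Finset.mem_product, Finset.mem_filter, Finset.mem_univ,
      true_and, blockKey_mul_inv] at h ⊢
    exact (strictMono_blockKey_snake_iff u t π τ g (f ∘ τ) h.1).2 h.2
  · rintro ⟨τ, f, g⟩ h ⟨τ', f', g'⟩ h' he
    simp only [Finset.mem_sigma, Finset.mem_product, Finset.mem_filter, Finset.mem_univ,
      true_and, blockKey_mul_inv] at h h' he
    have hg : g = g' := funext fun i => ((snake_inj t).1 (congrFun he i)).1
    have hf : f ∘ τ = f' ∘ τ' := funext fun i => ((snake_inj t).1 (congrFun he i)).2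
    rw [← hf] at h'
    have hτ : blockKey u π (f ∘ τ) ∘ ⇑τ⁻¹ = blockKey u π (f ∘ τ) ∘ ⇑τ'⁻¹ := by
      -- Both sides enumerate the same set of keys increasingly, so they agree; hence `φ` determines
      -- `τ`.
      refine (StrictMono.range_inj h.1 h'.1).1 ?_
      rw [Set.range_comp, Set.range_comp, Equiv.range_eq_univ, Equiv.range_eq_univ]
    have : τ = τ' := inv_injective
      (Equiv.ext fun i => blockKey_injective u π (f ∘ τ) (congrFun hτ i))
    subst this
    have : f = f' := τ.surjective.injective_comp_right hf
    subst this hg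
    rfl
  · intro h hh
    choose g φ hgφ using fun i => exists_snake_eq t (h i)
    obtain rfl : (fun i => snake t (g i) (φ i)) = h := funext hgφ
    -- The only possible choice: the standardisation of the key of `(φ, π)`.
    set τ : Equiv.Perm (Fin n) := (Tuple.sort (blockKey u π φ))⁻¹ with hτ
    have hsort : StrictMono (blockKey u π φ ∘ ⇑τ⁻¹) := by
      rw [hτ, inv_inv]
      exact (Tuple.monotone_sort _).strictMono_of_injective
        ((blockKey_injective u π φ).comp (Equiv.injective _))
    have hφ : (φ ∘ ⇑τ⁻¹) ∘ τ = φ := by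
      funext i
      simp
    refine ⟨⟨τ, φ ∘ ⇑τ⁻¹, g⟩, ?_, ?_⟩
    · simp only [Finset.mem_sigma, Finset.mem_product, Finset.mem_filter, Finset.mem_univ,
        true_and, blockKey_mul_inv, hφ] at hh ⊢
      exact ⟨hsort, (strictMono_blockKey_snake_iff u t π τ g φ hsort).1 hh⟩
    · funext i
      simp

theorem intMul_altProd (u t : ℤˣ) (k l : ℕ) :
    intMul (altProd u k) (altProd t l) = toGroupAlg (altProd (prodSign k u t) (k * l)) := by
  classical
  funext n
  refine MonoidAlgebra.ext (Finsupp.ext fun π => ?_)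
  -- The factorisations of `π` are exactly the pairs `(π * τ⁻¹, τ)`.
  have hinj : Function.Injective fun τ : Equiv.Perm (Fin n) => (π * τ⁻¹, τ) :=
    fun _ _ h => congrArg Prod.snd h
  rw [intMul, toGroupAlg, coeff_altProd, ← sum_card_mul_card,
    MonoidAlgebra.coeff_mul_antidiag _ _ π (Finset.univ.map ⟨_, hinj⟩), Finset.sum_map]
  · simp only [Function.Embedding.coeFn_mk, coeff_altProd, Nat.cast_sum, Nat.cast_mul]
  · rintro ⟨a, b⟩
    simp only [Finset.mem_map, Finset.mem_univ, true_and, Function.Embedding.coeFn_mk,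
      Prod.mk.injEq]
    constructor
    · rintro ⟨τ, rfl, rfl⟩
      simp
    · rintro rfl
      exact ⟨b, by simp, rfl⟩

theorem altProd_one (k : ℕ) : altProd 1 k = Vplus k := if_pos rfl

theorem altProd_neg_one (k : ℕ) : altProd (-1) k = Vminus k := if_neg (by decide)

end NSym

theorem mainTheorem2 (k l : ℕ) :
    NSym.intMul (NSym.Vplus k) (NSym.Vplus l) = NSym.toGroupAlg (NSym.Vplus (k * l)) ∧
    NSym.intMul (NSym.Vminus k) (NSym.Vplus l) = NSym.toGroupAlg (NSym.Vminus (k * l)) ∧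
    (Even k →
      NSym.intMul (NSym.Vplus k) (NSym.Vminus l) = NSym.toGroupAlg (NSym.Vplus (k * l)) ∧
      NSym.intMul (NSym.Vminus k) (NSym.Vminus l) = NSym.toGroupAlg (NSym.Vminus (k * l))) ∧
    (Odd k →
      NSym.intMul (NSym.Vplus k) (NSym.Vminus l) = NSym.toGroupAlg (NSym.Vminus (k * l)) ∧
      NSym.intMul (NSym.Vminus k) (NSym.Vminus l) = NSym.toGroupAlg (NSym.Vplus (k * l))) := by
  simp only [← NSym.altProd_one, ← NSym.altProd_neg_one, NSym.intMul_altProd]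
  refine ⟨?_, ?_, fun hk => ?_, fun hk => ?_⟩
  · simp [NSym.prodSign]
  · simp [NSym.prodSign]
  · simp [NSym.prodSign, hk]
  · simp [NSym.prodSign, Nat.not_even_iff_odd.2 hk]
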